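/- Let $I=[a,b)$ be an interval with $a<b$, equipped with the normalized Lebesgue measure $|\cdot|/|I|$, and let $\mathcal F_n$ be the $\sigma$-algebra generated by the $2^n$ dyadic subintervals $[a+k|I|2^{-n},\,a+(k+1)|I|2^{-n})$, $0\le k<2^n$, of $I$. A dyadic martingale on $I$ is a martingale $\{f_n\}_{n\ge 0}$ with respect to $(\mathcal F_n)_{n\ge0}$, for instance $f_n=\mathbb E[f\mid\mathcal F_n]$ with $f\in L^1(I)$. Write $Sf_n=\big(\sum_{k=1}^n (f_k-f_{k-1})^2\big)^{1/2}$. Then $\alpha=2$ is the smallest real constant such that $$\mathbb E\,e^{f_n}\le \mathbb E\,e^{\alpha (Sf_n)^2}$$ holds for every dyadic martingale $\{f_n\}$ on $I$ with $f_0=0$ and every $n\in\mathbb N$. The constant $\alpha=2$ is also the smallest one for which this holds when only the martingales $f_n=\mathbb E[f\mid\mathcal F_n]$ with $f\in L^1(I)$ and $f_0=0$ are considered. -/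

import Mathlib

open MeasureTheory ProbabilityTheory

/-- The `k`-th dyadic subinterval of generation `n` of the interval `I = [a, b)`, that is
`[a + k |I| 2⁻ⁿ, a + (k + 1) |I| 2⁻ⁿ)`, as a subset of `I`. -/
def dyadicCell (a b : ℝ) (n k : ℕ) : Set (Set.Ico a b) :=
  {ω | a + k * ((b - a) / 2 ^ n) ≤ (ω : ℝ) ∧ (ω : ℝ) < a + (k + 1) * ((b - a) / 2 ^ n)}

theorem measurableSet_dyadicCell (a b : ℝ) (n k : ℕ) : MeasurableSet (dyadicCell a b n k) :=
  (measurableSet_le measurable_const measurable_subtype_coe).inter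
    (measurableSet_lt measurable_subtype_coe measurable_const)

theorem dyadicCell_eq_union (a b : ℝ) (n k : ℕ) :
    dyadicCell a b n k = dyadicCell a b (n + 1) (2 * k) ∪ dyadicCell a b (n + 1) (2 * k + 1) := by
  ext ω
  have hlt : (a : ℝ) < b := lt_of_le_of_lt ω.2.1 ω.2.2
  have hd : 0 < (b - a) / 2 ^ (n + 1) := div_pos (sub_pos.2 hlt) (by positivity)
  have h2 : (b - a) / 2 ^ n = 2 * ((b - a) / 2 ^ (n + 1)) := by
    rw [pow_succ]; field_simp
  simp only [dyadicCell, Set.mem_union, Set.mem_ofPred_eq, h2]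
  push_cast
  generalize (b - a) / 2 ^ (n + 1) = d at hd
  constructor
  · rintro ⟨h, h'⟩
    rcases lt_or_ge (ω : ℝ) (a + (2 * k + 1) * d) with hc | hc
    · exact Or.inl ⟨by linarith, hc⟩
    · exact Or.inr ⟨hc, by linarith⟩
  · rintro (⟨h, h'⟩ | ⟨h, h'⟩)
    · exact ⟨by linarith, by linarith⟩
    · exact ⟨by linarith, by linarith⟩

/-- The dyadic filtration of `[a, b)`: the `n`-th σ-algebra is generated by the `2 ^ n` dyadic
subintervals of `[a, b)` of length `(b - a) 2⁻ⁿ`. -/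
def dyadicFiltration (a b : ℝ) :
    Filtration ℕ (inferInstance : MeasurableSpace (Set.Ico a b)) where
  seq n := MeasurableSpace.generateFrom {s | ∃ k < 2 ^ n, s = dyadicCell a b n k}
  mono' := by
    refine monotone_nat_of_le_succ fun n => MeasurableSpace.generateFrom_le ?_
    rintro s ⟨k, hk, rfl⟩
    rw [dyadicCell_eq_union]
    have hc : ∀ j < 2 ^ (n + 1), MeasurableSet[MeasurableSpace.generateFrom
        {s | ∃ k < 2 ^ (n + 1), s = dyadicCell a b (n + 1) k}] (dyadicCell a b (n + 1) j) :=
      fun j hj => MeasurableSpace.measurableSet_generateFrom ⟨j, hj, rfl⟩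
    have hp : 2 ^ (n + 1) = 2 * 2 ^ n := by rw [pow_succ, mul_comm]
    exact MeasurableSet.union (hc _ (by omega)) (hc _ (by omega))
  le' n := by
    refine MeasurableSpace.generateFrom_le ?_
    rintro s ⟨k, -, rfl⟩
    exact measurableSet_dyadicCell a b n k

/-- Normalized Lebesgue measure `|·| / |I|` on the interval `I = [a, b)`. -/
noncomputable def dyadicMeasure (a b : ℝ) : Measure (Set.Ico a b) :=
  (ENNReal.ofReal (b - a))⁻¹ • Measure.comap Subtype.val volume

theorem isProbabilityMeasure_dyadicMeasure {a b : ℝ} (hab : a < b) :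
    IsProbabilityMeasure (dyadicMeasure a b) := by
  refine ⟨?_⟩
  have h : (Measure.comap Subtype.val volume : Measure (Set.Ico a b)) Set.univ =
      ENNReal.ofReal (b - a) := by
    rw [comap_subtype_coe_apply measurableSet_Ico, Set.image_univ, Subtype.range_coe,
      Real.volume_Ico]
  rw [dyadicMeasure, Measure.smul_apply, h, smul_eq_mul]
  exact ENNReal.inv_mul_cancel (by simpa using hab) ENNReal.ofReal_ne_top

/-- A dyadic martingale on `[a, b)`: a martingale for the dyadic filtration and normalized
Lebesgue measure. -/
def IsDyadicMartingale (a b : ℝ) (f : ℕ → Set.Ico a b → ℝ) : Prop :=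
  Martingale f (dyadicFiltration a b) (dyadicMeasure a b)

/-- The dyadic martingale `f_n = 𝔼[F | 𝓕_n]` generated by `F ∈ L¹([a, b))`. -/
noncomputable def dyadicMartingaleOf (a b : ℝ) (F : Set.Ico a b → ℝ) : ℕ → Set.Ico a b → ℝ :=
  fun n => (dyadicMeasure a b)[F | dyadicFiltration a b n]

/-- The square function `S f_n = (∑_{k=1}^n (f_k - f_{k-1})²)^{1/2}`. -/
noncomputable def squareFunction {Ω : Type*} (f : ℕ → Ω → ℝ) (n : ℕ) (ω : Ω) : ℝ :=
  √(∑ k ∈ Finset.range n, (f (k + 1) ω - f k ω) ^ 2)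

/-- The inequality `𝔼 e^{f_n} ≤ 𝔼 e^{α (S f_n)²}` at every time `n`. Both integrands take only
finitely many values when `f` is adapted to the dyadic filtration, so they are integrable. -/
def ExpSquareInequality (a b : ℝ) (α : ℝ) (f : ℕ → Set.Ico a b → ℝ) : Prop :=
  ∀ n : ℕ, ∫ ω, Real.exp (f n ω) ∂(dyadicMeasure a b) ≤
    ∫ ω, Real.exp (α * squareFunction f n ω ^ 2) ∂(dyadicMeasure a b)

/-!
Every dyadic martingale is determined by its values on the dyadic cells, and the expectation of a
function that is constant on the cells of generation `n` is the average `dyadicMean n` over the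
`2 ^ n` cell indices. Both halves of the theorem are statements about such finite averages, and the
tower property `dyadicMean_succ` turns them into one-step estimates.

*The constant `2` works.* As `cosh (2 t) ≤ exp (2 t²)`, the process `exp (2 fₙ - 2 (S fₙ)²)` is a
supermartingale, so its mean is at most `1`. By the inequality between the arithmetic and the
geometric mean `2 exp fₙ ≤ exp (2 fₙ - 2 (S fₙ)²) + exp (2 (S fₙ)²)`, and
`1 ≤ 𝔼 exp (2 (S fₙ)²)`; hence `dyadicMean_exp_le_dyadicMean_exp_two_mul_cellSquare`.

*No `α < 2` works.* Let `f` be a random walk with small steps `± δ`, let `y` be `f` minus the drift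
`d ≈ θ δ²` per step, and stop when `y` leaves a fixed window `(-w, w)`. This imitates Brownian
motion stopped when it leaves a strip around the line `x = θ t`. Because `y` is bounded and
`exp (α (S fₙ)² + θ yₙ)` is a supermartingale if `α < θ² / 2`, the moments `𝔼 exp (α (S fₙ)²)` are
bounded (`dyadicMean_exp_cellSquare_stoppedWalk_le`). On the other hand
`h y = exp ((θ - 1) y) cos (φ y)` with `w = π / (2 φ)` is an eigenfunction of the step operator
weighted by `exp (± δ)`, positive inside the window and nonpositive just outside it, with
eigenvalue about `1 + δ² (2 θ - θ² - φ²) / 2`. This exceeds `1` if `θ < 2` and `φ` is small, and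
then `𝔼 exp fₙ` grows geometrically (`le_dyadicMean_exp_stoppedWalk`). For `α < 2` both conditions
on `θ` can be met. Freezing the walk at a finite time makes it a martingale `𝔼[F | 𝓕ₙ]`
with `F` bounded, so one example serves both classes of martingales.
-/

/-! ### Averages over the dyadic cells of one generation -/

/-- The average of `ψ` over the `2 ^ n` cell indices of generation `n`; this is the expectation of
the function equal to `ψ k` on the `k`-th cell. -/
noncomputable def dyadicMean (n : ℕ) (ψ : ℕ → ℝ) : ℝ :=
  (∑ k ∈ Finset.range (2 ^ n), ψ k) / 2 ^ n

theorem dyadicMean_zero (ψ : ℕ → ℝ) : dyadicMean 0 ψ = ψ 0 := by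
  simp [dyadicMean]

theorem dyadicMean_const (n : ℕ) (c : ℝ) : dyadicMean n (fun _ => c) = c := by
  simp [dyadicMean]

theorem dyadicMean_mono {n : ℕ} {ψ χ : ℕ → ℝ} (h : ∀ k < 2 ^ n, ψ k ≤ χ k) :
    dyadicMean n ψ ≤ dyadicMean n χ := by
  unfold dyadicMean
  gcongr with k hk
  exact h k (Finset.mem_range.1 hk)

theorem dyadicMean_congr {n : ℕ} {ψ χ : ℕ → ℝ} (h : ∀ k < 2 ^ n, ψ k = χ k) :
    dyadicMean n ψ = dyadicMean n χ :=
  le_antisymm (dyadicMean_mono fun k hk => (h k hk).le) (dyadicMean_mono fun k hk => (h k hk).ge)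

theorem dyadicMean_add (n : ℕ) (ψ χ : ℕ → ℝ) :
    dyadicMean n (fun k => ψ k + χ k) = dyadicMean n ψ + dyadicMean n χ := by
  simp only [dyadicMean, Finset.sum_add_distrib, add_div]

theorem dyadicMean_const_mul (n : ℕ) (c : ℝ) (ψ : ℕ → ℝ) :
    dyadicMean n (fun k => c * ψ k) = c * dyadicMean n ψ := by
  simp only [dyadicMean, ← Finset.mul_sum, mul_div_assoc]

theorem sum_range_two_mul (ψ : ℕ → ℝ) (m : ℕ) :
    ∑ j ∈ Finset.range (2 * m), ψ j = ∑ k ∈ Finset.range m, (ψ (2 * k) + ψ (2 * k + 1)) := by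
  induction m with
  | zero => simp
  | succ m ih => rw [Nat.mul_succ, Finset.sum_range_succ, Finset.sum_range_succ, ih,
      Finset.sum_range_succ]; ring

/-- The tower property: averaging over generation `n + 1` amounts to averaging first over the two
children `2 k` and `2 k + 1` of each cell `k` of generation `n`. -/
theorem dyadicMean_succ (n : ℕ) (ψ : ℕ → ℝ) :
    dyadicMean (n + 1) ψ = dyadicMean n fun k => (ψ (2 * k) + ψ (2 * k + 1)) / 2 := by
  unfold dyadicMean
  rw [pow_succ' 2 n, sum_range_two_mul, pow_succ' (2 : ℝ) n, ← Finset.sum_div, div_div]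

/-! ### The square function on cells and the upper bound -/

/-- The square of the square function at generation `n` on the cell of index `k`, for the process
taking the value `φ n k` on that cell. -/
noncomputable def cellSquare (φ : ℕ → ℕ → ℝ) : ℕ → ℕ → ℝ
  | 0, _ => 0
  | n + 1, j => cellSquare φ n (j / 2) + (φ (n + 1) j - φ n (j / 2)) ^ 2

theorem cellSquare_nonneg (φ : ℕ → ℕ → ℝ) (n k : ℕ) : 0 ≤ cellSquare φ n k := by
  induction n generalizing k with
  | zero => exact le_rfl
  | succ n ih => exact add_nonneg (ih _) (sq_nonneg _)

/-- `exp (2 fₙ - 2 (S fₙ)²)` is a supermartingale: its conditional expectation brings in a factor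
`cosh (2 t) exp (-2 t²) ≤ 1`. -/
theorem dyadicMean_exp_sub_cellSquare_le_one {φ : ℕ → ℕ → ℝ}
    (hφ : ∀ n, ∀ k < 2 ^ n, φ n k = (φ (n + 1) (2 * k) + φ (n + 1) (2 * k + 1)) / 2)
    (h0 : φ 0 0 = 0) (n : ℕ) :
    dyadicMean n (fun k => Real.exp (2 * φ n k - 2 * cellSquare φ n k)) ≤ 1 := by
  induction n with
  | zero => simp [dyadicMean_zero, h0, cellSquare]
  | succ n ih =>
    rw [dyadicMean_succ]
    refine (dyadicMean_mono fun k hk => ?_).trans ih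
    have e2 : (2 * k + 1) / 2 = k := by omega
    have e1 : (2 * k) / 2 = k := by omega
    simp only [cellSquare, e1, e2]
    set t := φ (n + 1) (2 * k) - φ n k with ht
    have h1 : φ (n + 1) (2 * k) = φ n k + t := by rw [ht]; ring
    have h2 : φ (n + 1) (2 * k + 1) = φ n k - t := by rw [ht, hφ n k hk]; ring
    rw [h1, h2]
    have hc := Real.cosh_le_exp_half_sq (2 * t)
    rw [Real.cosh_eq] at hc
    generalize cellSquare φ n k = s
    generalize φ n k = x
    calc (Real.exp (2 * (x + t) - 2 * (s + t ^ 2))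
          + Real.exp (2 * (x - t) - 2 * (s + (x - t - x) ^ 2))) / 2
        = Real.exp (2 * x - 2 * s) * Real.exp (-(2 * t ^ 2))
          * ((Real.exp (2 * t) + Real.exp (-(2 * t))) / 2) := by
          have e (u v : ℝ) : Real.exp (2 * x - 2 * s) * Real.exp (-(2 * t ^ 2))
              * ((Real.exp u + Real.exp v) / 2) = (Real.exp (2 * x - 2 * s + -(2 * t ^ 2) + u)
                + Real.exp (2 * x - 2 * s + -(2 * t ^ 2) + v)) / 2 := by
            simp only [Real.exp_add]; ring
          rw [e]
          ring_nf
      _ ≤ Real.exp (2 * x - 2 * s) * Real.exp (-(2 * t ^ 2)) * Real.exp ((2 * t) ^ 2 / 2) := by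
          gcongr
      _ = Real.exp (2 * x - 2 * s) := by
          rw [← Real.exp_add, ← Real.exp_add]; ring_nf

theorem dyadicMean_exp_le_dyadicMean_exp_two_mul_cellSquare {φ : ℕ → ℕ → ℝ}
    (hφ : ∀ n, ∀ k < 2 ^ n, φ n k = (φ (n + 1) (2 * k) + φ (n + 1) (2 * k + 1)) / 2)
    (h0 : φ 0 0 = 0) (n : ℕ) :
    dyadicMean n (fun k => Real.exp (φ n k)) ≤
      dyadicMean n (fun k => Real.exp (2 * cellSquare φ n k)) := by
  have h1 : (1 : ℝ) ≤ dyadicMean n (fun k => Real.exp (2 * cellSquare φ n k)) := by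
    rw [← dyadicMean_const n 1]
    refine dyadicMean_mono fun k _ => Real.one_le_exp ?_
    have := cellSquare_nonneg φ n k
    positivity
  have h2 : dyadicMean n (fun k => Real.exp (φ n k)) ≤
      dyadicMean n (fun k => (1 / 2) * (Real.exp (2 * φ n k - 2 * cellSquare φ n k)
        + Real.exp (2 * cellSquare φ n k))) := by
    refine dyadicMean_mono fun k _ => ?_
    have e1 : Real.exp (2 * φ n k - 2 * cellSquare φ n k)
        = Real.exp (φ n k - cellSquare φ n k) ^ 2 := by
      rw [← Real.exp_nat_mul]; push_cast; ring_nf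
    have e2 : Real.exp (2 * cellSquare φ n k) = Real.exp (cellSquare φ n k) ^ 2 := by
      rw [← Real.exp_nat_mul]; push_cast; ring_nf
    have e3 : Real.exp (φ n k)
        = Real.exp (φ n k - cellSquare φ n k) * Real.exp (cellSquare φ n k) := by
      rw [← Real.exp_add]; ring_nf
    rw [e1, e2, e3]
    linarith [two_mul_le_add_sq (Real.exp (φ n k - cellSquare φ n k))
      (Real.exp (cellSquare φ n k))]
  rw [dyadicMean_const_mul, dyadicMean_add] at h2
  linarith [dyadicMean_exp_sub_cellSquare_le_one hφ h0 n]

/-! ### The stopped random walk -/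

/-- A random walk with steps `± δ`, stopped once its drifted copy leaves `(-w, w)`: the first
component is the walk, the second one is the walk minus `d` times the number of steps made.
The step from a cell to its left child is `δ`, to its right child `-δ`. -/
noncomputable def stoppedWalk (w δ d : ℝ) : ℕ → ℕ → ℝ × ℝ
  | 0, _ => (0, 0)
  | n + 1, j =>
    if |(stoppedWalk w δ d n (j / 2)).2| < w then
      ((stoppedWalk w δ d n (j / 2)).1 + (-1) ^ j * δ,
        (stoppedWalk w δ d n (j / 2)).2 + (-1) ^ j * δ - d)
    else stoppedWalk w δ d n (j / 2)

theorem stoppedWalk_left (w δ d : ℝ) (n k : ℕ) :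
    stoppedWalk w δ d (n + 1) (2 * k) = if |(stoppedWalk w δ d n k).2| < w then
      ((stoppedWalk w δ d n k).1 + δ, (stoppedWalk w δ d n k).2 + δ - d)
    else stoppedWalk w δ d n k := by
  have e1 : (2 * k) / 2 = k := by omega
  simp [stoppedWalk, e1]

theorem stoppedWalk_right (w δ d : ℝ) (n k : ℕ) :
    stoppedWalk w δ d (n + 1) (2 * k + 1) = if |(stoppedWalk w δ d n k).2| < w then
      ((stoppedWalk w δ d n k).1 - δ, (stoppedWalk w δ d n k).2 - δ - d)
    else stoppedWalk w δ d n k := by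
  have e2 : (2 * k + 1) / 2 = k := by omega
  simp [stoppedWalk, e2, pow_succ, sub_eq_add_neg]

theorem stoppedWalk_martingale (w δ d : ℝ) (n k : ℕ) :
    (stoppedWalk w δ d n k).1 = ((stoppedWalk w δ d (n + 1) (2 * k)).1
      + (stoppedWalk w δ d (n + 1) (2 * k + 1)).1) / 2 := by
  rw [stoppedWalk_left, stoppedWalk_right]
  split_ifs <;> ring

theorem le_stoppedWalk_snd {w δ d : ℝ} (hw : 0 < w) (hδ : 0 < δ) (h : δ + d ≤ 2 * w) (n j : ℕ) :
    -(3 * w) ≤ (stoppedWalk w δ d n j).2 := by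
  induction n generalizing j with
  | zero => simp only [stoppedWalk]; linarith
  | succ n ih =>
    rw [stoppedWalk]
    split_ifs with hy
    · have := (abs_lt.1 hy).1
      have h1 : -δ ≤ (-1) ^ j * δ := by
        rcases neg_one_pow_eq_or ℝ j with h | h <;> rw [h] <;> linarith
      dsimp only
      linarith
    · exact ih _

/-- If `exp (α δ²) cosh (θ δ) exp (-θ d) ≤ 1`, then `exp (α (S fₙ)² + θ yₙ)` is a supermartingale,
where `y` is the drifted walk. As `y` is bounded below, this bounds `𝔼 exp (α (S fₙ)²)`. -/
theorem dyadicMean_exp_cellSquare_stoppedWalk_le {w δ d α θ : ℝ} (hw : 0 < w) (hδ : 0 < δ)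
    (hd : δ + d ≤ 2 * w) (hθ : 0 ≤ θ)
    (h : Real.exp (α * δ ^ 2) * Real.cosh (θ * δ) * Real.exp (-(θ * d)) ≤ 1) (n : ℕ) :
    dyadicMean n (fun k => Real.exp
      (α * cellSquare (fun m j => (stoppedWalk w δ d m j).1) n k)) ≤ Real.exp (θ * (3 * w)) := by
  set φ : ℕ → ℕ → ℝ := fun m j => (stoppedWalk w δ d m j).1 with hφ
  have key : dyadicMean n (fun k => Real.exp
      (α * cellSquare φ n k + θ * (stoppedWalk w δ d n k).2)) ≤ 1 := by
    induction n with
    | zero => simp [dyadicMean_zero, cellSquare, stoppedWalk]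
    | succ n ih =>
      rw [dyadicMean_succ]
      refine (dyadicMean_mono fun k _ => ?_).trans ih
      have e2 : (2 * k + 1) / 2 = k := by omega
      have e1 : (2 * k) / 2 = k := by omega
      simp only [cellSquare, e1, e2, hφ, stoppedWalk_left, stoppedWalk_right]
      rw [← hφ]
      generalize cellSquare φ n k = s
      split_ifs with hy
      · dsimp only
        generalize (stoppedWalk w δ d n k).1 = x
        generalize (stoppedWalk w δ d n k).2 = y
        rw [Real.cosh_eq] at h
        calc _ = Real.exp (α * s + θ * y) * (Real.exp (α * δ ^ 2)
              * ((Real.exp (θ * δ) + Real.exp (-(θ * δ))) / 2) * Real.exp (-(θ * d))) := by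
              have e (u v : ℝ) : Real.exp (α * s + θ * y) * (Real.exp (α * δ ^ 2)
                * ((Real.exp u + Real.exp v) / 2) * Real.exp (-(θ * d))) =
                (Real.exp (α * s + θ * y + α * δ ^ 2 + u + -(θ * d))
                  + Real.exp (α * s + θ * y + α * δ ^ 2 + v + -(θ * d))) / 2 := by
                simp only [Real.exp_add]; ring
              rw [e]
              ring_nf
          _ ≤ Real.exp (α * s + θ * y) * 1 := by gcongr
          _ = _ := mul_one _
      · simp
  calc _ ≤ dyadicMean n (fun k => Real.exp (θ * (3 * w)) * Real.exp
      (α * cellSquare φ n k + θ * (stoppedWalk w δ d n k).2)) := by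
        refine dyadicMean_mono fun k _ => ?_
        rw [← Real.exp_add]
        refine Real.exp_le_exp.2 ?_
        have := mul_le_mul_of_nonneg_left (le_stoppedWalk_snd hw hδ hd n k) hθ
        linarith
    _ ≤ Real.exp (θ * (3 * w)) * 1 := by
        rw [dyadicMean_const_mul]; gcongr
    _ = _ := mul_one _

/-- Suppose that `h` vanishes or is negative where the stopped walk can land outside `(-w, w)`, and
that `exp x * h y` is multiplied by `κ` in the mean by one step of the walk. Then
`exp xₙ h yₙ`, restricted to the event that the walk has not been stopped, has mean at least
`κ ^ n h 0`, and so the exponential moments of the walk grow at least geometrically. -/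
theorem le_dyadicMean_exp_stoppedWalk {w δ d κ C : ℝ} {h : ℝ → ℝ} (hw : 0 < w) (hδ : 0 < δ)
    (hd0 : 0 ≤ d) (hd : δ + d ≤ 2 * w) (hκ : 0 ≤ κ) (hC : ∀ y, |y| < w → h y ≤ C) (hC0 : 0 ≤ C)
    (hout : ∀ y, w ≤ |y| → |y| ≤ 3 * w → h y ≤ 0)
    (heig : ∀ y, (Real.exp δ * h (y + δ - d) + Real.exp (-δ) * h (y - δ - d)) / 2 = κ * h y)
    (n : ℕ) :
    κ ^ n * h 0 ≤ C * dyadicMean n (fun k => Real.exp (stoppedWalk w δ d n k).1) := by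
  set H : ℝ → ℝ := fun y => if |y| < w then h y else 0 with hH
  have hle (y : ℝ) (hy : |y| ≤ 3 * w) : h y ≤ H y := by
    simp only [hH]
    split_ifs with h1
    · exact le_rfl
    · exact hout y (not_lt.1 h1) hy
  have key : κ ^ n * h 0 ≤ dyadicMean n (fun k =>
      Real.exp (stoppedWalk w δ d n k).1 * H (stoppedWalk w δ d n k).2) := by
    induction n with
    | zero => simp [dyadicMean_zero, stoppedWalk, hH, hw]
    | succ n ih =>
      rw [pow_succ', mul_assoc, dyadicMean_succ]
      refine (mul_le_mul_of_nonneg_left ih hκ).trans ?_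
      rw [← dyadicMean_const_mul]
      refine dyadicMean_mono fun k _ => ?_
      rw [stoppedWalk_left, stoppedWalk_right]
      split_ifs with hy
      · dsimp only
        generalize (stoppedWalk w δ d n k).1 = x
        generalize (stoppedWalk w δ d n k).2 = y at *
        have hHy : H y = h y := if_pos hy
        have hy' := abs_lt.1 hy
        have h1 := hle (y + δ - d) (abs_le.2 ⟨by linarith, by linarith⟩)
        have h2 := hle (y - δ - d) (abs_le.2 ⟨by linarith, by linarith⟩)
        rw [hHy]
        calc κ * (Real.exp x * h y)
            = Real.exp x * ((Real.exp δ * h (y + δ - d)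
                + Real.exp (-δ) * h (y - δ - d)) / 2) := by rw [heig]; ring
          _ ≤ Real.exp x * ((Real.exp δ * H (y + δ - d)
                + Real.exp (-δ) * H (y - δ - d)) / 2) := by gcongr
          _ = _ := by rw [sub_eq_add_neg x δ, Real.exp_add, Real.exp_add]; ring
      · simp [hH, hy]
  refine key.trans ?_
  rw [← dyadicMean_const_mul]
  refine dyadicMean_mono fun k _ => ?_
  rw [mul_comm]
  gcongr
  simp only [hH]
  split_ifs with h1
  · exact hC _ h1
  · exact hC0

/-! ### Choice of the parameters of the walk -/

open Filter Topology in
theorem tendsto_sinh_mul_div (θ : ℝ) :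
    Tendsto (fun δ : ℝ => Real.sinh (θ * δ) / δ) (𝓝[>] 0) (𝓝 θ) := by
  have h : HasDerivAt (fun δ : ℝ => Real.sinh (θ * δ)) θ 0 := by
    simpa using (((hasDerivAt_id (0 : ℝ)).const_mul θ).sinh)
  simpa [div_eq_inv_mul] using h.tendsto_slope_zero_right

open Filter Topology in
theorem tendsto_sin_mul_div (φ : ℝ) :
    Tendsto (fun δ : ℝ => Real.sin (φ * δ) / δ) (𝓝[>] 0) (𝓝 φ) := by
  have h : HasDerivAt (fun δ : ℝ => Real.sin (φ * δ)) φ 0 := by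
    simpa using (((hasDerivAt_id (0 : ℝ)).const_mul φ).sin)
  simpa [div_eq_inv_mul] using h.tendsto_slope_zero_right

open Filter Topology in
/-- For `d = arctan (tanh (θ δ) tan (φ δ)) / φ` the function `exp ((θ - 1) y) cos (φ y)` is an exact
eigenfunction, and `d / δ² → θ` as `δ → 0`. -/
theorem tendsto_drift_div_sq {θ φ : ℝ} (hφ : 0 < φ) :
    Tendsto (fun δ : ℝ => Real.arctan (Real.sinh (θ * δ) * Real.sin (φ * δ)
      / (Real.cosh (θ * δ) * Real.cos (φ * δ))) / φ / δ ^ 2) (𝓝[>] 0) (𝓝 θ) := by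
  have hS := tendsto_sinh_mul_div θ
  have hT := tendsto_sin_mul_div φ
  have hch : Tendsto (fun δ : ℝ => Real.cosh (θ * δ)) (𝓝[>] 0) (𝓝 1) := by
    have : Continuous fun δ : ℝ => Real.cosh (θ * δ) := by fun_prop
    simpa using (this.tendsto 0).mono_left nhdsWithin_le_nhds
  have hco : Tendsto (fun δ : ℝ => Real.cos (φ * δ)) (𝓝[>] 0) (𝓝 1) := by
    have : Continuous fun δ : ℝ => Real.cos (φ * δ) := by fun_prop
    simpa using (this.tendsto 0).mono_left nhdsWithin_le_nhds
  set u : ℝ → ℝ := fun δ => Real.sinh (θ * δ) * Real.sin (φ * δ)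
      / (Real.cosh (θ * δ) * Real.cos (φ * δ)) with hu
  have hu2 : Tendsto (fun δ => u δ / δ ^ 2) (𝓝[>] 0) (𝓝 (θ * φ)) := by
    have h := (hS.mul hT).div (hch.mul hco) (by norm_num)
    simp only [mul_one, div_one] at h
    refine h.congr fun δ => ?_
    simp only [hu, Pi.div_apply]
    rw [div_mul_div_comm, div_div, div_div, ← pow_two, mul_comm (δ ^ 2)]
  have hu0 : Tendsto u (𝓝[>] 0) (𝓝 0) := by
    have h2 : Tendsto (fun δ : ℝ => δ ^ 2) (𝓝[>] 0) (𝓝 0) := by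
      have : Continuous fun δ : ℝ => δ ^ 2 := by fun_prop
      simpa using (this.tendsto 0).mono_left nhdsWithin_le_nhds
    have h := hu2.mul h2
    rw [mul_zero] at h
    refine h.congr' ?_
    filter_upwards [self_mem_nhdsWithin] with δ (hδ : 0 < δ)
    field_simp
  -- `dslope` gives `arctan u = u * s(u)` with `s` continuous at `0`, without excluding `u = 0`.
  have hsl : Tendsto (fun δ => dslope Real.arctan 0 (u δ)) (𝓝[>] 0) (𝓝 1) := by
    have h1 : ContinuousAt (dslope Real.arctan 0) 0 :=
      continuousAt_dslope_same.2 (Real.differentiableAt_arctan 0)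
    have h2 : dslope Real.arctan 0 0 = 1 := by simp [dslope_same]
    rw [ContinuousAt, h2] at h1
    exact h1.comp hu0
  have hat (x : ℝ) : Real.arctan x = x * dslope Real.arctan 0 x := by
    have := sub_smul_dslope Real.arctan 0 x
    simpa using this.symm
  have h := (hu2.mul hsl).div_const φ
  rw [mul_one, mul_div_cancel_right₀ _ hφ.ne'] at h
  refine h.congr fun δ => ?_
  rw [show Real.sinh (θ * δ) * Real.sin (φ * δ)
      / (Real.cosh (θ * δ) * Real.cos (φ * δ)) = u δ from rfl, hat (u δ)]
  ring

/-- The eigenvalue equation for `exp ((θ - 1) y) cos (φ y)`. -/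
theorem exp_mul_cos_eigen {θ φ δ : ℝ} (hφ : φ ≠ 0) (hcos : 0 < Real.cos (φ * δ)) (y : ℝ) {d r : ℝ}
    (hd : d = Real.arctan (Real.sinh (θ * δ) * Real.sin (φ * δ)
      / (Real.cosh (θ * δ) * Real.cos (φ * δ))) / φ)
    (hr : r = √(1 + Real.sinh (θ * δ) ^ 2 - Real.sin (φ * δ) ^ 2)) :
    (Real.exp δ * (Real.exp ((θ - 1) * (y + δ - d)) * Real.cos (φ * (y + δ - d)))
      + Real.exp (-δ) * (Real.exp ((θ - 1) * (y - δ - d)) * Real.cos (φ * (y - δ - d)))) / 2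
    = Real.exp (-((θ - 1) * d)) * r * (Real.exp ((θ - 1) * y) * Real.cos (φ * y)) := by
  set C := Real.cosh (θ * δ) * Real.cos (φ * δ) with hCdef
  set S := Real.sinh (θ * δ) * Real.sin (φ * δ) with hSdef
  have hC : 0 < C := mul_pos (Real.cosh_pos _) hcos
  have hφd : φ * d = Real.arctan (S / C) := by rw [hd]; exact mul_div_cancel₀ _ hφ
  have hq : 0 < √(1 + (S / C) ^ 2) := by positivity
  have hr' : r = √(1 + (S / C) ^ 2) * C := by
    have h : 1 + Real.sinh (θ * δ) ^ 2 - Real.sin (φ * δ) ^ 2 = (1 + (S / C) ^ 2) * (C * C) := by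
      have h1 : (1 + (S / C) ^ 2) * (C * C) = C ^ 2 + S ^ 2 := by
        field_simp
      rw [h1, hCdef, hSdef, mul_pow, mul_pow, Real.cosh_sq (θ * δ), Real.cos_sq' (φ * δ)]
      ring
    rw [hr, h, Real.sqrt_mul (by positivity), Real.sqrt_mul_self hC.le]
  have hcd : r * Real.cos (φ * d) = C := by
    rw [hφd, Real.cos_arctan, hr']
    field_simp
  have hsd : r * Real.sin (φ * d) = S := by
    rw [hφd, Real.sin_arctan, hr']
    field_simp
  have e1 : Real.exp δ * Real.exp ((θ - 1) * (y + δ - d))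
      = Real.exp (-((θ - 1) * d)) * Real.exp ((θ - 1) * y) * Real.exp (θ * δ) := by
    simp only [← Real.exp_add]; ring_nf
  have e2 : Real.exp (-δ) * Real.exp ((θ - 1) * (y - δ - d))
      = Real.exp (-((θ - 1) * d)) * Real.exp ((θ - 1) * y) * Real.exp (-(θ * δ)) := by
    simp only [← Real.exp_add]; ring_nf
  have c1 : φ * (y + δ - d) = (φ * y - φ * d) + φ * δ := by ring
  have c2 : φ * (y - δ - d) = (φ * y - φ * d) - φ * δ := by ring
  have hy : r * Real.cos (φ * y) = Real.cosh (θ * δ) * Real.cos (φ * δ) * Real.cos (φ * y - φ * d)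
      - Real.sinh (θ * δ) * Real.sin (φ * δ) * Real.sin (φ * y - φ * d) := by
    rw [← hCdef, ← hSdef, ← hcd, ← hsd]
    calc r * Real.cos (φ * y) = r * Real.cos ((φ * y - φ * d) + φ * d) := by ring_nf
      _ = _ := by rw [Real.cos_add]; ring
  rw [Real.cosh_eq, Real.sinh_eq] at hy
  rw [← mul_assoc, ← mul_assoc, e1, e2, c1, c2, Real.cos_add (φ * y - φ * d),
    Real.cos_sub (φ * y - φ * d)]
  linear_combination -(Real.exp (-((θ - 1) * d)) * Real.exp ((θ - 1) * y)) * hy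

open Filter Topology in
theorem exists_walk_parameters {α : ℝ} (hα : α < 2) :
    ∃ θ φ δ d κ : ℝ, 1 < θ ∧ 0 < φ ∧ 0 < δ ∧ 0 ≤ d ∧ 1 < κ ∧ δ + d ≤ Real.pi / φ ∧
      Real.exp (α * δ ^ 2) * Real.cosh (θ * δ) * Real.exp (-(θ * d)) ≤ 1 ∧
      ∀ y, (Real.exp δ * (Real.exp ((θ - 1) * (y + δ - d)) * Real.cos (φ * (y + δ - d)))
        + Real.exp (-δ) * (Real.exp ((θ - 1) * (y - δ - d)) * Real.cos (φ * (y - δ - d)))) / 2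
        = κ * (Real.exp ((θ - 1) * y) * Real.cos (φ * y)) := by
  obtain ⟨θ, hθ1, hθ2, hθα⟩ : ∃ θ : ℝ, 1 < θ ∧ θ < 2 ∧ α < θ ^ 2 / 2 := by
    rcases le_total α 0 with h | h
    · exact ⟨3 / 2, by norm_num, by norm_num, by linarith⟩
    · exact ⟨(6 + α) / 4, by linarith, by linarith, by nlinarith⟩
  obtain ⟨φ, hφ, hφθ⟩ : ∃ φ : ℝ, 0 < φ ∧ φ ^ 2 < 2 * θ - θ ^ 2 := by
    have h : 0 < 2 * θ - θ ^ 2 := by nlinarith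
    refine ⟨√((2 * θ - θ ^ 2) / 2), by positivity, ?_⟩
    rw [Real.sq_sqrt (by positivity)]
    linarith
  set D : ℝ → ℝ := fun δ => Real.arctan (Real.sinh (θ * δ) * Real.sin (φ * δ)
      / (Real.cosh (θ * δ) * Real.cos (φ * δ))) / φ with hD
  have hDlim : Tendsto (fun δ => D δ / δ ^ 2) (𝓝[>] 0) (𝓝 θ) := tendsto_drift_div_sq hφ
  have h2 : Tendsto (fun δ : ℝ => δ ^ 2) (𝓝[>] 0) (𝓝 0) := by
    have : Continuous fun δ : ℝ => δ ^ 2 := by fun_prop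
    simpa using (this.tendsto 0).mono_left nhdsWithin_le_nhds
  have h1 : Tendsto (fun δ : ℝ => δ) (𝓝[>] 0) (𝓝 0) := nhdsWithin_le_nhds
  have hD0 : Tendsto (fun δ => δ + D δ) (𝓝[>] 0) (𝓝 0) := by
    have h := h1.add (hDlim.mul h2)
    rw [mul_zero, add_zero] at h
    refine h.congr' ?_
    filter_upwards [self_mem_nhdsWithin] with δ (hδ : 0 < δ)
    field_simp
  set A : ℝ → ℝ := fun δ => (Real.sinh (θ * δ) / δ) ^ 2 - (Real.sin (φ * δ) / δ) ^ 2 with hA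
  have hAlim : Tendsto A (𝓝[>] 0) (𝓝 (θ ^ 2 - φ ^ 2)) :=
    ((tendsto_sinh_mul_div θ).pow 2).sub ((tendsto_sin_mul_div φ).pow 2)
  have hBlim : Tendsto (fun δ => A δ - 2 * (θ - 1) * (1 + A δ * δ ^ 2) * (D δ / δ ^ 2)) (𝓝[>] 0)
      (𝓝 (2 * θ - θ ^ 2 - φ ^ 2)) := by
    have h := hAlim.sub ((((hAlim.mul h2).const_add 1).const_mul (2 * (θ - 1))).mul hDlim)
    convert h using 2
    ring
  have hcos : Tendsto (fun δ : ℝ => Real.cos (φ * δ)) (𝓝[>] 0) (𝓝 1) := by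
    have : Continuous fun δ : ℝ => Real.cos (φ * δ) := by fun_prop
    simpa using (this.tendsto 0).mono_left nhdsWithin_le_nhds
  have hθα' : (α + θ ^ 2 / 2) / θ < θ := by
    rw [div_lt_iff₀ (by linarith)]; linarith
  obtain ⟨δ, hδ, hB, hdθ, hd0, hsmall, hc⟩ := ((eventually_mem_nhdsWithin (a := (0 : ℝ))
    (s := Set.Ioi 0)).and ((hBlim.eventually_const_lt (by linarith : (0 : ℝ) < 2 * θ - θ ^ 2 - φ ^ 2)).and
    ((hDlim.eventually_const_lt hθα').and ((hDlim.eventually_const_lt (by linarith : 0 < θ)).and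
    ((hD0.eventually_lt_const (by positivity : 0 < Real.pi / φ)).and
    (hcos.eventually_const_lt one_pos)))))).exists
  replace hδ : 0 < δ := hδ
  have hδ2 : 0 < δ ^ 2 := by positivity
  have hd : 0 < D δ := by
    have := mul_pos hd0 hδ2
    rwa [div_mul_cancel₀ _ hδ2.ne'] at this
  set r := √(1 + Real.sinh (θ * δ) ^ 2 - Real.sin (φ * δ) ^ 2) with hr
  have hr2 : r ^ 2 = 1 + A δ * δ ^ 2 := by
    rw [hr, Real.sq_sqrt (by nlinarith [Real.sin_sq_le_one (φ * δ), sq_nonneg (Real.sinh (θ * δ))])]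
    simp only [hA]
    field_simp
    ring
  have hκ : 1 < Real.exp (-((θ - 1) * D δ)) * r := by
    refine (one_lt_sq_iff₀ (by positivity)).1 ?_
    rw [mul_pow, ← Real.exp_nat_mul]
    have he := Real.add_one_le_exp (((2 : ℕ) : ℝ) * -((θ - 1) * D δ))
    have h3 := mul_pos hB hδ2
    have h4 : (A δ - 2 * (θ - 1) * (1 + A δ * δ ^ 2) * (D δ / δ ^ 2)) * δ ^ 2
        = (1 - 2 * (θ - 1) * D δ) * r ^ 2 - 1 := by
      rw [hr2]; field_simp; ring
    have h5 := mul_le_mul_of_nonneg_right he (sq_nonneg r)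
    push_cast at h5 ⊢
    linarith
  refine ⟨θ, φ, δ, D δ, _, hθ1, hφ, hδ, hd.le, hκ, hsmall.le, ?_, fun y =>
    exp_mul_cos_eigen hφ.ne' hc y rfl hr⟩
  rw [div_lt_div_iff₀ (by linarith) hδ2] at hdθ
  calc _ ≤ Real.exp (α * δ ^ 2) * Real.exp ((θ * δ) ^ 2 / 2) * Real.exp (-(θ * D δ)) := by
        gcongr; exact Real.cosh_le_exp_half_sq _
    _ = Real.exp ((α + θ ^ 2 / 2) * δ ^ 2 - D δ * θ) := by
        rw [← Real.exp_add, ← Real.exp_add]; ring_nf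
    _ ≤ 1 := Real.exp_le_one_iff.2 (by linarith)

/-- For `α < 2` the exponential inequality with constant `α` fails for some stopped walk. -/
theorem exists_stoppedWalk_exp_lt {α : ℝ} (hα : α < 2) : ∃ w δ d : ℝ, ∃ n : ℕ,
    dyadicMean n (fun k => Real.exp
      (α * cellSquare (fun m j => (stoppedWalk w δ d m j).1) n k))
    < dyadicMean n (fun k => Real.exp (stoppedWalk w δ d n k).1) := by
  obtain ⟨θ, φ, δ, d, κ, hθ, hφ, hδ, hd, hκ, hsmall, hexp, heig⟩ := exists_walk_parameters hα
  have hpi := Real.pi_pos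
  set w := Real.pi / 2 / φ with hw
  have hw0 : 0 < w := by positivity
  have hφw : φ * w = Real.pi / 2 := by rw [hw]; field_simp
  have hsmall' : δ + d ≤ 2 * w := by
    rw [hw]; convert hsmall using 1; ring
  have hup := dyadicMean_exp_cellSquare_stoppedWalk_le hw0 hδ hsmall' (by linarith) hexp
  have hlow := le_dyadicMean_exp_stoppedWalk (C := Real.exp ((θ - 1) * w))
    (h := fun y => Real.exp ((θ - 1) * y) * Real.cos (φ * y)) hw0 hδ hd hsmall' (by linarith)
    (fun y hy => by
      have hy' := (abs_lt.1 hy).2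
      calc _ ≤ Real.exp ((θ - 1) * y) * 1 := by gcongr; exact Real.cos_le_one _
        _ ≤ Real.exp ((θ - 1) * w) := by
          rw [mul_one, Real.exp_le_exp]
          exact mul_le_mul_of_nonneg_left hy'.le (by linarith))
    (Real.exp_pos _).le
    (fun y h1 h2 => by
      refine mul_nonpos_of_nonneg_of_nonpos (Real.exp_pos _).le ?_
      rw [← Real.cos_abs, abs_mul, abs_of_pos hφ]
      have e1 := mul_le_mul_of_nonneg_left h1 hφ.le
      have e2 := mul_le_mul_of_nonneg_left h2 hφ.le
      exact Real.cos_nonpos_of_pi_div_two_le_of_le (by linarith) (by linarith))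
    heig
  obtain ⟨n, hn⟩ := pow_unbounded_of_one_lt
    (Real.exp ((θ - 1) * w) * Real.exp (θ * (3 * w))) hκ
  refine ⟨w, δ, d, n, (hup n).trans_lt ?_⟩
  have h := hlow n
  simp only [mul_zero, Real.exp_zero, Real.cos_zero, mul_one] at h
  exact lt_of_mul_lt_mul_left (hn.trans_le h) (Real.exp_pos _).le

/-! ### The index of the dyadic cell containing a point -/

/-- The index `k` of the cell `dyadicCell a b n k` containing `ω`. -/
noncomputable def cellIndex (a b : ℝ) (n : ℕ) (ω : Set.Ico a b) : ℕ :=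
  ⌊((ω : ℝ) - a) / ((b - a) / 2 ^ n)⌋₊

variable {a b : ℝ}

theorem mem_dyadicCell_iff (n k : ℕ) (ω : Set.Ico a b) :
    ω ∈ dyadicCell a b n k ↔ cellIndex a b n ω = k := by
  have hlt : a < b := lt_of_le_of_lt ω.2.1 ω.2.2
  have hd : 0 < (b - a) / 2 ^ n := div_pos (sub_pos.2 hlt) (by positivity)
  rw [cellIndex, Nat.floor_eq_iff (div_nonneg (sub_nonneg.2 ω.2.1) hd.le), le_div_iff₀ hd,
    div_lt_iff₀ hd]
  simp only [dyadicCell, Set.mem_ofPred_eq]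
  constructor <;> rintro ⟨h1, h2⟩ <;> constructor <;> linarith

theorem cellIndex_lt (n : ℕ) (ω : Set.Ico a b) : cellIndex a b n ω < 2 ^ n := by
  have hlt : a < b := lt_of_le_of_lt ω.2.1 ω.2.2
  have hd : 0 < (b - a) / 2 ^ n := div_pos (sub_pos.2 hlt) (by positivity)
  rw [cellIndex, Nat.floor_lt (div_nonneg (sub_nonneg.2 ω.2.1) hd.le), div_lt_iff₀ hd]
  push_cast
  rw [mul_div_cancel₀ _ (by positivity)]
  linarith [ω.2.2]

theorem cellIndex_succ_div_two (n : ℕ) (ω : Set.Ico a b) :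
    cellIndex a b (n + 1) ω / 2 = cellIndex a b n ω := by
  have h := Nat.floor_div_natCast (((ω : ℝ) - a) / ((b - a) / 2 ^ (n + 1))) 2
  rw [cellIndex, cellIndex, ← h]
  congr 1
  push_cast
  rw [div_div, pow_succ]
  congr 1
  field_simp

theorem measurable_cellIndex_dyadicFiltration (n : ℕ) :
    Measurable[dyadicFiltration a b n] (cellIndex a b n) := by
  refine @measurable_to_countable' _ _ _ _ (dyadicFiltration a b n) _ fun k => ?_
  by_cases hk : k < 2 ^ n
  · have h : cellIndex a b n ⁻¹' {k} = dyadicCell a b n k := by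
      ext ω; simp [mem_dyadicCell_iff]
    rw [h]
    exact MeasurableSpace.measurableSet_generateFrom ⟨k, hk, rfl⟩
  · have h : cellIndex a b n ⁻¹' {k} = ∅ := by
      ext ω
      have := cellIndex_lt n ω
      simp only [Set.mem_preimage, Set.mem_singleton_iff, Set.mem_empty_iff_false, iff_false]
      omega
    rw [h]
    exact @MeasurableSet.empty _ (dyadicFiltration a b n)

theorem dyadicFiltration_le_comap_cellIndex (n : ℕ) :
    (dyadicFiltration a b n : MeasurableSpace (Set.Ico a b)) ≤
      MeasurableSpace.comap (cellIndex a b n) ⊤ := by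
  refine MeasurableSpace.generateFrom_le ?_
  rintro s ⟨k, -, rfl⟩
  refine ⟨{k}, trivial, ?_⟩
  ext ω; simp [mem_dyadicCell_iff]

theorem exists_eq_comp_cellIndex {n : ℕ} {f : Set.Ico a b → ℝ}
    (hf : StronglyMeasurable[dyadicFiltration a b n] f) :
    ∃ ψ : ℕ → ℝ, f = ψ ∘ cellIndex a b n := by
  have h : Measurable[MeasurableSpace.comap (cellIndex a b n) ⊤] f :=
    hf.measurable.mono (dyadicFiltration_le_comap_cellIndex n) le_rfl
  obtain ⟨ψ, -, hψ⟩ := Measurable.exists_eq_measurable_comp h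
  exact ⟨ψ, hψ⟩

theorem measureReal_dyadicCell (hab : a < b) {n k : ℕ} (hk : k < 2 ^ n) :
    (dyadicMeasure a b).real (dyadicCell a b n k) = (2 ^ n)⁻¹ := by
  have hba : 0 < b - a := sub_pos.2 hab
  have hd : 0 < (b - a) / 2 ^ n := by positivity
  have himg : Subtype.val '' dyadicCell a b n k =
      Set.Ico (a + k * ((b - a) / 2 ^ n)) (a + (k + 1) * ((b - a) / 2 ^ n)) := by
    ext x
    constructor
    · rintro ⟨ω, hω, rfl⟩; exact hω
    · rintro hx
      have hk' : ((k : ℝ) + 1) ≤ 2 ^ n := by exact_mod_cast hk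
      have h1 : (k + 1) * ((b - a) / 2 ^ n) ≤ 2 ^ n * ((b - a) / 2 ^ n) := by gcongr
      rw [mul_div_cancel₀ _ (by positivity)] at h1
      have h2 : 0 ≤ k * ((b - a) / 2 ^ n) := by positivity
      exact ⟨⟨x, by linarith [hx.1], by linarith [hx.2]⟩, hx, rfl⟩
  rw [Measure.real, dyadicMeasure, Measure.smul_apply, comap_subtype_coe_apply measurableSet_Ico,
    himg, Real.volume_Ico, smul_eq_mul, ENNReal.toReal_mul, ENNReal.toReal_inv,
    ENNReal.toReal_ofReal hba.le, ENNReal.toReal_ofReal (by linarith)]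
  field_simp
  ring

/-! ### Integrals of functions that are constant on cells -/

theorem comp_cellIndex_eq_sum (n : ℕ) (ψ : ℕ → ℝ) :
    (fun ω => ψ (cellIndex a b n ω)) = fun ω => ∑ k ∈ Finset.range (2 ^ n),
      (dyadicCell a b n k).indicator (fun _ => ψ k) ω := by
  ext ω
  rw [Finset.sum_eq_single_of_mem _ (Finset.mem_range.2 (cellIndex_lt n ω))]
  · rw [Set.indicator_of_mem ((mem_dyadicCell_iff _ _ _).2 rfl)]
  · intro k _ hk
    exact Set.indicator_of_notMem (fun h => hk ((mem_dyadicCell_iff _ _ _).1 h).symm) _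

theorem integrable_comp_cellIndex (hab : a < b) (n : ℕ) (ψ : ℕ → ℝ) :
    Integrable (fun ω => ψ (cellIndex a b n ω)) (dyadicMeasure a b) := by
  have := isProbabilityMeasure_dyadicMeasure hab
  rw [comp_cellIndex_eq_sum]
  exact integrable_finsetSum _ fun k _ =>
    (integrable_const _).indicator (measurableSet_dyadicCell a b n k)

theorem integral_comp_cellIndex (hab : a < b) (n : ℕ) (ψ : ℕ → ℝ) :
    ∫ ω, ψ (cellIndex a b n ω) ∂(dyadicMeasure a b) = dyadicMean n ψ := by
  have := isProbabilityMeasure_dyadicMeasure hab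
  rw [comp_cellIndex_eq_sum, integral_finsetSum _ fun k _ =>
    (integrable_const _).indicator (measurableSet_dyadicCell a b n k), dyadicMean, Finset.sum_div]
  refine Finset.sum_congr rfl fun k hk => ?_
  rw [integral_indicator_const _ (measurableSet_dyadicCell a b n k),
    measureReal_dyadicCell hab (Finset.mem_range.1 hk), smul_eq_mul, inv_mul_eq_div]

theorem squareFunction_sq_eq_cellSquare (φ : ℕ → ℕ → ℝ) (n : ℕ) (ω : Set.Ico a b) :
    squareFunction (fun m ω => φ m (cellIndex a b m ω)) n ω ^ 2
      = cellSquare φ n (cellIndex a b n ω) := by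
  rw [squareFunction, Real.sq_sqrt (Finset.sum_nonneg fun _ _ => sq_nonneg _)]
  induction n with
  | zero => simp [cellSquare]
  | succ n ih => rw [Finset.sum_range_succ, ih, cellSquare, cellIndex_succ_div_two]

theorem integral_exp_comp_cellIndex (hab : a < b) (φ : ℕ → ℕ → ℝ) (n : ℕ) :
    ∫ ω, Real.exp (φ n (cellIndex a b n ω)) ∂(dyadicMeasure a b)
      = dyadicMean n fun k => Real.exp (φ n k) :=
  integral_comp_cellIndex hab n fun k => Real.exp (φ n k)

theorem integral_exp_squareFunction (hab : a < b) (φ : ℕ → ℕ → ℝ) (α : ℝ) (n : ℕ) :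
    ∫ ω, Real.exp (α * squareFunction (fun m ω => φ m (cellIndex a b m ω)) n ω ^ 2)
      ∂(dyadicMeasure a b) = dyadicMean n fun k => Real.exp (α * cellSquare φ n k) := by
  simp only [squareFunction_sq_eq_cellSquare]
  exact integral_comp_cellIndex hab n fun k => Real.exp (α * cellSquare φ n k)

/-! ### Dyadic martingales in terms of cell values -/

/-- The integral over the set of points whose generation `n` cell has its index in `T`. -/
theorem setIntegral_comp_cellIndex (hab : a < b) (n : ℕ) (T : Set ℕ) (ψ : ℕ → ℝ) :
    ∫ ω in cellIndex a b n ⁻¹' T, ψ (cellIndex a b n ω) ∂(dyadicMeasure a b)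
      = dyadicMean n (T.indicator ψ) := by
  have hm : MeasurableSet (cellIndex a b n ⁻¹' T) :=
    (dyadicFiltration a b).le n _ (measurable_cellIndex_dyadicFiltration n trivial)
  rw [← integral_indicator hm, ← integral_comp_cellIndex hab]
  rfl

theorem setIntegral_comp_cellIndex_succ (hab : a < b) (n : ℕ) (T : Set ℕ) (ψ : ℕ → ℝ) :
    ∫ ω in cellIndex a b n ⁻¹' T, ψ (cellIndex a b (n + 1) ω) ∂(dyadicMeasure a b)
      = dyadicMean n (T.indicator fun k => (ψ (2 * k) + ψ (2 * k + 1)) / 2) := by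
  have h : cellIndex a b n ⁻¹' T = cellIndex a b (n + 1) ⁻¹' ((· / 2) ⁻¹' T) := by
    ext ω; simp [cellIndex_succ_div_two]
  rw [h, setIntegral_comp_cellIndex hab, dyadicMean_succ]
  refine dyadicMean_congr fun k _ => ?_
  have e2 : (2 * k + 1) / 2 = k := by omega
  have e1 : (2 * k) / 2 = k := by omega
  by_cases hk : k ∈ T <;> simp [Set.indicator, e1, e2, hk]

/-- A process given by cell values is a dyadic martingale when each value is the average of the
values on the two children. -/
theorem isDyadicMartingale_comp_cellIndex (hab : a < b) {φ : ℕ → ℕ → ℝ}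
    (hφ : ∀ n k, φ n k = (φ (n + 1) (2 * k) + φ (n + 1) (2 * k + 1)) / 2) :
    IsDyadicMartingale a b fun n ω => φ n (cellIndex a b n ω) := by
  have := isProbabilityMeasure_dyadicMeasure hab
  have had (n : ℕ) : StronglyMeasurable[dyadicFiltration a b n]
      fun ω => φ n (cellIndex a b n ω) := by
    refine Measurable.stronglyMeasurable ?_
    exact (measurable_from_top (f := φ n)).comp (measurable_cellIndex_dyadicFiltration n)
  refine martingale_nat had (fun n => integrable_comp_cellIndex hab n _) fun n => ?_
  refine ae_eq_condExp_of_forall_setIntegral_eq ((dyadicFiltration a b).le n)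
    (integrable_comp_cellIndex hab (n + 1) _)
    (fun s _ _ => (integrable_comp_cellIndex hab n _).integrableOn) (fun s hs _ => ?_)
    (had n).aestronglyMeasurable
  obtain ⟨T, -, rfl⟩ := dyadicFiltration_le_comap_cellIndex n s hs
  rw [setIntegral_comp_cellIndex hab, setIntegral_comp_cellIndex_succ hab]
  congr 2
  ext k
  exact hφ n k

/-- Every dyadic martingale is given by cell values, each of them the average of the values on the
two children. -/
theorem IsDyadicMartingale.exists_cell_values (hab : a < b) {f : ℕ → Set.Ico a b → ℝ}
    (hf : IsDyadicMartingale a b f) : ∃ φ : ℕ → ℕ → ℝ,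
      (f = fun n ω => φ n (cellIndex a b n ω)) ∧
      ∀ n, ∀ k < 2 ^ n, φ n k = (φ (n + 1) (2 * k) + φ (n + 1) (2 * k + 1)) / 2 := by
  have := isProbabilityMeasure_dyadicMeasure hab
  choose φ hφ using fun n => exists_eq_comp_cellIndex (hf.1 n)
  have hfφ : f = fun n ω => φ n (cellIndex a b n ω) := funext hφ
  refine ⟨φ, hfφ, fun n k hk => ?_⟩
  have hs : MeasurableSet[dyadicFiltration a b n] (cellIndex a b n ⁻¹' {k}) :=
    measurable_cellIndex_dyadicFiltration n trivial
  have h := Martingale.setIntegral_eq hf (Nat.le_succ n) hs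
  simp only [hfφ] at h
  rw [setIntegral_comp_cellIndex hab, Nat.succ_eq_add_one, setIntegral_comp_cellIndex_succ hab] at h
  have hmean (ψ : ℕ → ℝ) : dyadicMean n (({k} : Set ℕ).indicator ψ) = ψ k / 2 ^ n := by
    rw [dyadicMean, Finset.sum_eq_single_of_mem k (Finset.mem_range.2 hk)]
    · simp
    · intro j _ hj
      simp [hj]
  rw [hmean, hmean] at h
  exact (div_left_inj' (by positivity)).1 h

theorem IsDyadicMartingale.expSquareInequality (hab : a < b) {f : ℕ → Set.Ico a b → ℝ}
    (hf : IsDyadicMartingale a b f) (h0 : f 0 =ᵐ[dyadicMeasure a b] 0) :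
    ExpSquareInequality a b 2 f := by
  obtain ⟨φ, rfl, hφ⟩ := hf.exists_cell_values hab
  have h00 : φ 0 0 = 0 := by
    have h := integral_congr_ae h0
    rw [integral_comp_cellIndex hab, dyadicMean_zero] at h
    simpa using h
  intro n
  rw [integral_exp_comp_cellIndex hab, integral_exp_squareFunction hab]
  exact dyadicMean_exp_le_dyadicMean_exp_two_mul_cellSquare hφ h00 n

theorem isDyadicMartingale_dyadicMartingaleOf (hab : a < b) (F : Set.Ico a b → ℝ) :
    IsDyadicMartingale a b (dyadicMartingaleOf a b F) := by
  have := isProbabilityMeasure_dyadicMeasure hab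
  exact martingale_condExp F (dyadicFiltration a b) (dyadicMeasure a b)

/-- For `α < 2` the value at a suitable time of a stopped walk is a bounded function generating a
dyadic martingale for which the inequality with constant `α` fails. -/
theorem exists_not_expSquareInequality (hab : a < b) {α : ℝ} (hα : α < 2) :
    ∃ F : Set.Ico a b → ℝ, Integrable F (dyadicMeasure a b) ∧
      dyadicMartingaleOf a b F 0 =ᵐ[dyadicMeasure a b] 0 ∧
      ¬ ExpSquareInequality a b α (dyadicMartingaleOf a b F) := by
  obtain ⟨w, δ, d, N, hN⟩ := exists_stoppedWalk_exp_lt hα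
  set φ : ℕ → ℕ → ℝ := fun m j => (stoppedWalk w δ d m j).1
  have hmart : IsDyadicMartingale a b fun n ω => φ n (cellIndex a b n ω) :=
    isDyadicMartingale_comp_cellIndex hab (stoppedWalk_martingale w δ d)
  have hcond (n : ℕ) (hn : n ≤ N) :
      dyadicMartingaleOf a b (fun ω => φ N (cellIndex a b N ω)) n
        =ᵐ[dyadicMeasure a b] fun ω => φ n (cellIndex a b n ω) := hmart.2 n N hn
  refine ⟨fun ω => φ N (cellIndex a b N ω), integrable_comp_cellIndex hab N _,
    hcond 0 (Nat.zero_le N), fun h => ?_⟩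
  have hall : ∀ᵐ ω ∂(dyadicMeasure a b), ∀ n ≤ N,
      dyadicMartingaleOf a b (fun ω => φ N (cellIndex a b N ω)) n ω = φ n (cellIndex a b n ω) :=
    ae_all_iff.2 fun n => Filter.eventually_imp_distrib_left.2 (hcond n)
  have hexp : ∫ ω, Real.exp (dyadicMartingaleOf a b (fun ω => φ N (cellIndex a b N ω)) N ω)
      ∂(dyadicMeasure a b) = dyadicMean N fun k => Real.exp (φ N k) := by
    rw [← integral_exp_comp_cellIndex hab]
    exact integral_congr_ae (hall.mono fun ω hω => congrArg Real.exp (hω N le_rfl))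
  have hsq : ∫ ω, Real.exp (α * squareFunction
      (dyadicMartingaleOf a b fun ω => φ N (cellIndex a b N ω)) N ω ^ 2) ∂(dyadicMeasure a b)
      = dyadicMean N fun k => Real.exp (α * cellSquare φ N k) := by
    rw [← integral_exp_squareFunction hab]
    refine integral_congr_ae (hall.mono fun ω hω => ?_)
    have hsum : squareFunction (dyadicMartingaleOf a b fun ω => φ N (cellIndex a b N ω)) N ω
        = squareFunction (fun m ω => φ m (cellIndex a b m ω)) N ω := by
      refine congrArg Real.sqrt (Finset.sum_congr rfl fun k hk => ?_)
      have hk' := Finset.mem_range.1 hk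
      rw [hω (k + 1) hk', hω k hk'.le]
    simp only [hsum]
  have h1 := h N
  rw [hexp, hsq] at h1
  exact absurd hN (not_lt.2 h1)

theorem theorem3p8 (a b : ℝ) (hab : a < b) :
    IsLeast {α : ℝ | ∀ f : ℕ → Set.Ico a b → ℝ, IsDyadicMartingale a b f →
      f 0 =ᵐ[dyadicMeasure a b] 0 → ExpSquareInequality a b α f} 2 ∧
    IsLeast {α : ℝ | ∀ F : Set.Ico a b → ℝ, Integrable F (dyadicMeasure a b) →
      dyadicMartingaleOf a b F 0 =ᵐ[dyadicMeasure a b] 0 →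
        ExpSquareInequality a b α (dyadicMartingaleOf a b F)} 2 := by
  refine ⟨⟨fun f hf h0 => hf.expSquareInequality hab h0, fun α h => ?_⟩,
    ⟨fun F _ h0 => (isDyadicMartingale_dyadicMartingaleOf hab F).expSquareInequality hab h0,
      fun α h => ?_⟩⟩
  all_goals
    by_contra! hα
    obtain ⟨F, hF, h0, hnot⟩ := exists_not_expSquareInequality hab hα
  · exact hnot (h _ (isDyadicMartingale_dyadicMartingaleOf hab F) h0)
  · exact hnot (h F hF h0)
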